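/- Let $b\ge 2$ be an integer and let $A=(a_n)_{n\ge1}$ be a strictly increasing sequence of positive integers such that the limit $\eta:=\lim_{n\to\infty}\frac{a_{n+1}}{a_n}$ exists and $1<\eta<\infty$. Let $\|x\|$ denote the distance from $x\in\mathbb{R}$ to the nearest integer, and for $\xi\in\mathbb{R}$ let $\hat v_{b,A}(\xi)\in[0,\infty]$ be the supremum of the real numbers $v\ge 0$ such that, for all sufficiently large $N$, $$\min_{1\le n\le N}\|b^{a_n}\xi\|<(b^{a_N})^{-v}.$$ Put $$l_0=\max\left\{1,\left\lfloor\frac{\log 2-\log(\eta-1)}{\log\eta}\right\rfloor+1\right\}.$$ Then for every $$\hat v\in\left(\max\left\{1,\eta-\frac{2\eta}{\eta^{l_0}+1}\right\},\ \eta-\frac{2}{\eta^{l_0}}\right)\cup\bigcup_{l=l_0+1}^{\infty}\left(\eta-\frac{2\eta}{\eta^{l}+1},\ \eta-\frac{2}{\eta^{l}}\right),$$ with $$l_1=\left\lfloor\frac{\log 2-\log(\eta-\hat v)}{\log\eta}\right\rfloor+1,$$ the Hausdorff dimension of the set of real numbers with uniform exponent at least $\hat v$ satisfies $$\dim_{\rm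 H}\{\xi\in\mathbb{R}:\hat v_{b,A}(\xi)\ge\hat v\}\le\max\left\{\frac{\eta^{l_1+1}-1-\eta^{l_1}\hat v}{(\eta^{l_1+1}-1)(1+\eta^{l_1}\hat v)},\ \frac{\eta^{l_1}-1-\eta^{l_1-1}\hat v}{\eta^{l_1-1}\left(\eta(\eta^{l_1}-1)-\hat v\right)}\right\}<\left(\frac{\eta-\hat v}{\eta+\hat v}\right)^2 .$$ -/

import Mathlib

open Filter Topology
open scoped NNReal ENNReal

noncomputable section

/-- The distance `‖x‖` from a real number `x` to the nearest integer. -/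
def distNearestInt (x : ℝ) : ℝ := |x - round x|

/-- `v` is an admissible uniform exponent of `ξ`: for every sufficiently large `N` there is an index
`n ≤ N` with `‖b ^ (a n) ξ‖ < (b ^ (a N)) ^ (-v)`. The first term of the sequence is `a 0`. -/
def IsUniformExponent (b : ℕ) (a : ℕ → ℕ) (ξ v : ℝ) : Prop :=
  ∀ᶠ N in atTop, ∃ n ≤ N, distNearestInt ((b : ℝ) ^ a n * ξ) < ((b : ℝ) ^ a N) ^ (-v)

/-- The uniform exponent of approximation `v̂_{b,A}(ξ)`, the supremum in `[0, ∞]` of the real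
numbers `v ≥ 0` that are admissible for `ξ`. -/
def uniformExponent (b : ℕ) (a : ℕ → ℕ) (ξ : ℝ) : ℝ≥0∞ :=
  ⨆ (v : ℝ≥0) (_ : IsUniformExponent b a ξ v), (v : ℝ≥0∞)

/-- The set of all real `ξ` with `v̂_{b,A}(ξ) ≥ v`. -/
def uniformSet (b : ℕ) (a : ℕ → ℕ) (v : ℝ) : Set ℝ :=
  {ξ : ℝ | ENNReal.ofReal v ≤ uniformExponent b a ξ}

/-- `l₀ = max {1, ⌊(log 2 - log (η - 1)) / log η⌋ + 1}`. -/
def lZero (η : ℝ) : ℤ :=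
  max 1 (⌊(Real.log 2 - Real.log (η - 1)) / Real.log η⌋ + 1)

/-- `l₁ = ⌊(log 2 - log (η - v)) / log η⌋ + 1`. -/
def lOne (η v : ℝ) : ℤ :=
  ⌊(Real.log 2 - Real.log (η - v)) / Real.log η⌋ + 1

/-- The union of open intervals that the parameter `v̂` ranges over. -/
def parameterSet (η : ℝ) : Set ℝ :=
  Set.Ioo (max 1 (η - 2 * η / (η ^ lZero η + 1))) (η - 2 / η ^ lZero η) ∪
    ⋃ (l : ℤ) (_ : lZero η + 1 ≤ l), Set.Ioo (η - 2 * η / (η ^ l + 1)) (η - 2 / η ^ l)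

/-- The upper bound for the dimension, as a function of `η`, `v` and the integer `l = l₁`. -/
def dimensionBound (η v : ℝ) (l : ℤ) : ℝ :=
  max ((η ^ (l + 1) - 1 - η ^ l * v) / ((η ^ (l + 1) - 1) * (1 + η ^ l * v)))
    ((η ^ l - 1 - η ^ (l - 1) * v) / (η ^ (l - 1) * (η * (η ^ l - 1) - v)))

end

/-! For irrational ξ, let n_k be the successive record indices of ‖b^{a_n} ξ‖. An admissible
exponent v makes the record at n_k smaller than b^{-v a(n_{k+1}-1)}. So the base-b digits of ξ after
place a(n_k) are constant up to about `blockEnd`, and only `freeDigits` of them remain to be chosen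
before place a(n_{k+1}). Let S_k count the free digits before a(n_k). About b^{S_k} intervals of
radius b^{-blockEnd} cover the candidates with given n_0, ..., n_{k+1}, so if S_k ≤ s·blockEnd
infinitely often, every d > s bounds the dimension (`dimH_chainSet_le`).

If that inequality failed from some k on, x_k = S_k / a(n_k) would change at each step by at most
`drift s u Q`, where Q = a(n_{k+1}) / a(n_k) ≈ η^m and u ≈ v/η. Negative drift, made uniform over
all jumps in `exists_drift_le`, drives x_k below 0, which is absurd
(`frequently_sum_freeDigits_le`).

Hence the dimension is governed by f(Q) = ((1-u)Q-1)/((Q-1)(1+uQ)) at Q = η^m. This f rises up to Q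
= 2/(1-u), where its value is ((1-u)/(1+u))², and then falls. The range of v̂ puts the peak strictly
between η^l and η^{l+1} for l = l₁. The bound is the maximum of f(η^{l+1}) and a quantity dominating
f(η^l) whenever the latter is positive (`max_bound`); both lie below the peak value (`max_lt_sq`).
-/

/-! ### Optimization of the explicit bound -/

/-- Both terms of the dimension bound in the variables `u = v / η` and `Q = η ^ l`. -/
theorem dimensionBound_eq {η : ℝ} (hη : 1 < η) (v : ℝ) (l : ℤ) :
    dimensionBound η v l =
      max (((1 - v / η) * (η * η ^ l) - 1) / ((η * η ^ l - 1) * (1 + v / η * (η * η ^ l))))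
        (((1 - v / η) * η ^ l - 1) / (η ^ l * (η ^ l - 1 - v / η))) := by
  have h0 : η ≠ 0 := by positivity
  unfold dimensionBound
  rw [zpow_add_one₀ h0, zpow_sub_one₀ h0]
  congr 2 <;> field_simp <;> ring

/-- Membership in the interval of index l forces η^{l-1} ≤ 2/(η-v) < η^l, so the floor recovers l
and all the intervals can be treated alike. -/
theorem parameterSet_spec {η v : ℝ} (hη : 1 < η) (hv : v ∈ parameterSet η) :
    1 ≤ lOne η v ∧ 2 / η ^ lOne η v < η - v ∧ η - v < 2 * η / (η ^ lOne η v + 1) := by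
  have hpos : 0 < η := by positivity
  have key : ∀ l : ℤ, 1 ≤ l → η - 2 * η / (η ^ l + 1) < v → v < η - 2 / η ^ l →
      1 ≤ lOne η v ∧ 2 / η ^ lOne η v < η - v ∧ η - v < 2 * η / (η ^ lOne η v + 1) := by
    intro l hl h1 h2
    have hQ : 0 < η ^ l := zpow_pos hpos l
    have hw : 0 < η - v := by
      have : 0 < 2 / η ^ l := by positivity
      linarith
    have hlog : 0 < Real.log η := Real.log_pos hη
    have hl1 : lOne η v = l := by
      unfold lOne
      suffices ⌊(Real.log 2 - Real.log (η - v)) / Real.log η⌋ = l - 1 by omega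
      rw [← Real.log_div (by norm_num) hw.ne', Int.floor_eq_iff]
      constructor
      · rw [le_div_iff₀ hlog, ← Real.log_zpow, zpow_sub_one₀ hpos.ne']
        apply Real.log_le_log (by positivity)
        rw [le_div_iff₀ hw]
        have h3 : η - v < 2 * η / (η ^ l + 1) := by linarith
        rw [lt_div_iff₀ (by positivity)] at h3
        have : η ^ l * η⁻¹ * (η - v) = η ^ l * (η - v) / η := by ring
        rw [this, div_le_iff₀ hpos]
        nlinarith
      · have h3 : 2 / η ^ l < η - v := by linarith
        rw [div_lt_iff₀ hlog]
        have : ((l - 1 : ℤ) : ℝ) + 1 = (l : ℝ) := by push_cast; ring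
        rw [this, ← Real.log_zpow]
        apply Real.log_lt_log (by positivity)
        rw [div_lt_iff₀ hw]
        rw [div_lt_iff₀ hQ] at h3
        linarith
    rw [hl1]
    exact ⟨hl, by linarith, by linarith⟩
  have hl0 : 1 ≤ lZero η := le_max_left _ _
  rcases hv with hv | hv
  · exact key _ hl0 (lt_of_le_of_lt (le_max_right _ _) hv.1) hv.2
  · simp only [Set.mem_iUnion] at hv
    obtain ⟨l, hl, hv⟩ := hv
    exact key l (by omega) hv.1 hv.2

/-- The expression whose supremum over `Q` governs the dimension is unimodal in `Q`. -/
theorem mul_le_mul_of_unimodal {t u P Q : ℝ} (htu : t = 1 - u) (hu : 0 < u)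
    (h : 0 ≤ (P - Q) * (P + Q - t * P * Q)) :
    (t * Q - 1) * ((P - 1) * (1 + u * P)) ≤ (t * P - 1) * ((Q - 1) * (1 + u * Q)) := by
  subst htu
  nlinarith [mul_nonneg hu.le h]

/-- The denominator of the second term of the bound is positive. -/
theorem second_denominator_pos {η u Q : ℝ} (hη : 1 < η) (hQ : η ≤ Q)
    (h1 : 2 / (η * Q) < 1 - u) : 0 < Q - 1 - u := by
  have hηp : 0 < η := by positivity
  have hQp : 0 < Q := by linarith
  rw [div_lt_iff₀ (by positivity)] at h1
  have h3 : 0 < η * Q * (Q - 2) + 2 := by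
    rcases le_total 2 Q with h | h
    · have : 0 ≤ η * Q * (Q - 2) := by
        apply mul_nonneg (by positivity); linarith
      linarith
    -- For η ≤ Q ≤ 2 the quantity is at least Q³ - 2Q² + 2, whose minimum over Q > 0 is 22/27, at Q
    -- = 4/3.
    · nlinarith [mul_nonneg (mul_nonneg hQp.le (sub_nonneg.2 hQ)) (sub_nonneg.2 h),
        mul_nonneg hQp.le (sq_nonneg (Q - 4 / 3)), sq_nonneg (Q - 4 / 3)]
  by_contra hcon
  have : η * Q * (Q - 1 - u) ≤ 0 := mul_nonpos_of_nonneg_of_nonpos (by positivity) (by linarith)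
  nlinarith

/-- After clearing denominators the two differences are exactly the squares u((1-u)P-2)², with P =
ηQ, and (2-(1-u)(Q+1))². They are nonzero because the bounds on 1-u are strict. -/
theorem max_lt_sq {η u Q : ℝ} (hη : 1 < η) (hQ : η ≤ Q) (hu : 0 < u)
    (h1 : 2 / (η * Q) < 1 - u) (h2 : 1 - u < 2 / (Q + 1)) :
    max (((1 - u) * (η * Q) - 1) / ((η * Q - 1) * (1 + u * (η * Q))))
        (((1 - u) * Q - 1) / (Q * (Q - 1 - u))) < ((1 - u) / (1 + u)) ^ 2 := by
  have hQp : 0 < Q := by linarith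
  have hden := second_denominator_pos hη hQ h1
  have hηp : 0 < η := by positivity
  rw [div_lt_iff₀ (by positivity)] at h1
  rw [lt_div_iff₀ (by positivity)] at h2
  rw [div_pow]
  apply max_lt
  · have hP : 1 < η * Q := by nlinarith
    set P := η * Q with hPdef
    rw [div_lt_div_iff₀ (mul_pos (by linarith) (by positivity)) (by positivity)]
    have : 0 < u * ((1 - u) * P - 2) ^ 2 := by
      apply mul_pos hu; apply sq_pos_of_pos; linarith
    nlinarith
  · rw [div_lt_div_iff₀ (by positivity) (by positivity)]
    have : 0 < (2 - (1 - u) * (Q + 1)) ^ 2 := by apply sq_pos_of_pos; linarith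
    nlinarith

/-- No power of η lies strictly between Q and ηQ, and the peak 2/(1-u) does. Unimodality therefore
reduces each R to the nearer of these two values. -/
theorem max_bound {η u Q : ℝ} (hη : 1 < η) (hQ : η ≤ Q) (hu : 0 < u)
    (h1 : 2 / (η * Q) < 1 - u) (h2 : 1 - u < 2 / (Q + 1)) {D : ℝ}
    (hD : D = max (((1 - u) * (η * Q) - 1) / ((η * Q - 1) * (1 + u * (η * Q))))
        (((1 - u) * Q - 1) / (Q * (Q - 1 - u)))) :
    0 < D ∧ ∀ R, 1 < R → R ≤ Q ∨ η * Q ≤ R →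
      (1 - u) * R - 1 ≤ D * ((R - 1) * (1 + u * R)) := by
  have hQp : 0 < Q := by linarith
  have hden := second_denominator_pos hη hQ h1
  have hηp : 0 < η := by positivity
  rw [div_lt_iff₀ (by positivity)] at h1
  rw [lt_div_iff₀ (by positivity)] at h2
  have hP : 1 < η * Q := by nlinarith
  have hD1 : ((1 - u) * (η * Q) - 1) / ((η * Q - 1) * (1 + u * (η * Q))) ≤ D :=
    hD ▸ le_max_left _ _
  have hD2 : ((1 - u) * Q - 1) / (Q * (Q - 1 - u)) ≤ D := hD ▸ le_max_right _ _
  set P := η * Q with hPdef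
  have hPden : 0 < (P - 1) * (1 + u * P) := mul_pos (by linarith) (by positivity)
  have hDpos : 0 < D := lt_of_lt_of_le (div_pos (by linarith) hPden) hD1
  refine ⟨hDpos, fun R hR hR' => ?_⟩
  have hRden : 0 < (R - 1) * (1 + u * R) := mul_pos (by linarith) (by positivity)
  rcases hR' with hR' | hR'
  · rcases le_or_gt ((1 - u) * R - 1) 0 with h | h
    · exact h.trans (by positivity)
    have htQ : 0 < (1 - u) * Q - 1 := by nlinarith
    have hQ1 : 0 < (Q - 1) * (1 + u * Q) := mul_pos (by linarith) (by positivity)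
    have hD3 : ((1 - u) * Q - 1) / ((Q - 1) * (1 + u * Q)) ≤ D := by
      refine le_trans ?_ hD2
      apply div_le_div_of_nonneg_left htQ.le (by positivity)
      nlinarith
    rw [div_le_iff₀ hQ1] at hD3
    have hu1 : 0 < 1 - u := by nlinarith
    have := mul_le_mul_of_unimodal (t := 1 - u) (P := Q) (Q := R) rfl hu (by
      apply mul_nonneg (by linarith)
      have e1 : (1 - u) * Q ≤ 2 := by nlinarith
      nlinarith)
    refine le_of_mul_le_mul_right (a := (Q - 1) * (1 + u * Q)) (this.trans ?_) hQ1
    nlinarith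
  · rw [div_le_iff₀ hPden] at hD1
    have := mul_le_mul_of_unimodal (t := 1 - u) (P := P) (Q := R) rfl hu (by
      apply mul_nonneg_of_nonpos_of_nonpos (by linarith)
      have e1 : 2 ≤ (1 - u) * P := by nlinarith
      nlinarith)
    refine le_of_mul_le_mul_right (a := (P - 1) * (1 + u * P)) (this.trans ?_) hPden
    nlinarith

/-! ### Negativity of the drift -/

/-- An upper bound for the increment of the normalized number of free digits, when a block of
relative length `u` is followed by a jump by the factor `Q`, as long as the number of free digits
exceeds `s` times the scale. -/
noncomputable def drift (s u Q : ℝ) : ℝ := 1 - u - 1 / Q - s * (1 + u * Q) * (1 - 1 / Q)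

theorem drift_neg_iff {s u Q : ℝ} (hQ : 0 < Q) :
    drift s u Q < 0 ↔ (1 - u) * Q - 1 < s * ((Q - 1) * (1 + u * Q)) := by
  have h : drift s u Q = ((1 - u) * Q - 1 - s * ((Q - 1) * (1 + u * Q))) / Q := by
    unfold drift; field_simp
  rw [h, div_lt_iff₀ hQ, zero_mul, sub_neg]

/-- A uniform exponent at least v only yields admissible exponents below v, so u has to be lowered
slightly. The room between D and s pays for this uniformly in m. -/
theorem exists_params_drift_neg {η u D s : ℝ} (hη : 1 < η) (hu : 0 < u) (hD : 0 < D) (hs : D < s)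
    (h : ∀ m : ℕ, 1 ≤ m → (1 - u) * η ^ m - 1 ≤ D * ((η ^ m - 1) * (1 + u * η ^ m))) :
    ∃ u' s', 0 < u' ∧ u' < u ∧ 0 < s' ∧ s' < s ∧
      ∀ m : ℕ, 1 ≤ m → drift s' u' (η ^ m) < 0 := by
  set s' := (D + s) / 2 with hs'
  have hs'p : 0 < s' := by rw [hs']; linarith
  have hκ : 0 < 1 / (η - 1) + s' := by
    have : 0 < η - 1 := by linarith
    positivity
  -- Lowering u by w costs wQ(1 + s'(Q-1)), while the gain is at least (s'-D)(Q-1)uQ. Since 1 ≤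
  -- (Q-1)/(η-1), the second entry of the minimum makes the gain larger for every Q ≥ η.
  obtain ⟨w, hw0, hw⟩ := exists_between (show 0 < min u ((s' - D) * u / (1 / (η - 1) + s')) from
    lt_min hu (div_pos (mul_pos (by linarith) hu) hκ))
  have hwu : w < u := hw.trans_le (min_le_left _ _)
  have hw1 : w < (s' - D) * u / (1 / (η - 1) + s') := hw.trans_le (min_le_right _ _)
  rw [lt_div_iff₀ hκ] at hw1
  refine ⟨u - w, s', by linarith, by linarith, hs'p, by linarith, fun m hm => ?_⟩
  have hQ : η ≤ η ^ m := le_self_pow₀ hη.le (by omega)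
  have := h m hm
  set Q := η ^ m
  rw [drift_neg_iff (by linarith)]
  have e1 : 1 ≤ (Q - 1) * (1 / (η - 1)) := by
    rw [mul_one_div, one_le_div (by linarith)]; linarith
  have e2 : w * (1 + s' * (Q - 1)) ≤ (Q - 1) * (w * (1 / (η - 1) + s')) := by nlinarith
  have e3 : (Q - 1) * (w * (1 / (η - 1) + s')) < (Q - 1) * ((s' - D) * u) :=
    mul_lt_mul_of_pos_left hw1 (by linarith)
  have e4 : w * (1 + s' * (Q - 1)) * Q < (Q - 1) * ((s' - D) * u) * Q :=
    mul_lt_mul_of_pos_right (e2.trans_lt e3) (by linarith)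
  have e5 : 0 < (s' - D) * (Q - 1) := mul_pos (by linarith) (by linarith)
  nlinarith

theorem tendsto_ratio_pow {a : ℕ → ℕ} (ha_pos : ∀ n, 0 < a n) {η : ℝ}
    (hlim : Tendsto (fun n => (a (n + 1) : ℝ) / (a n : ℝ)) atTop (𝓝 η)) (m : ℕ) :
    Tendsto (fun n => (a (n + m) : ℝ) / (a n : ℝ)) atTop (𝓝 (η ^ m)) := by
  have hne : ∀ n, (a n : ℝ) ≠ 0 := fun n => by have := ha_pos n; positivity
  induction m with
  | zero => simp [hne]
  | succ m ih =>
    have h1 := hlim.comp (tendsto_add_atTop_nat m)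
    have h2 := ih.mul h1
    rw [pow_succ]
    refine h2.congr fun n => ?_
    simp only [Function.comp]
    rw [← add_assoc]
    field_simp [hne]

theorem pow_mul_le_of_ratio {a : ℕ → ℕ} {c : ℝ} (hc : 0 ≤ c) {n₀ : ℕ}
    (h : ∀ n ≥ n₀, c * a n ≤ a (n + 1)) (n : ℕ) (hn : n₀ ≤ n) (m : ℕ) :
    c ^ m * a n ≤ (a (n + m) : ℝ) := by
  induction m with
  | zero => simp
  | succ m ih =>
    have := h (n + m) (by omega)
    rw [pow_succ, ← add_assoc]
    nlinarith

/-- For each fixed m the drift converges to its negative limit. For large m the term -s·u·(Q-1)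
dominates, so finitely many m need the limit. -/
theorem exists_drift_le {a : ℕ → ℕ} (ha_pos : ∀ n, 0 < a n) {η : ℝ} (hη : 1 < η)
    (hlim : Tendsto (fun n => (a (n + 1) : ℝ) / (a n : ℝ)) atTop (𝓝 η)) {s v : ℝ} (hs : 0 < s)
    (hv : 0 < v) (h : ∀ m : ℕ, 1 ≤ m → drift s (v / η) (η ^ m) < 0) :
    ∃ δ > 0, ∃ n₀, ∀ n ≥ n₀, ∀ m ≥ 1,
      drift s (v * a (n + m - 1) / a (n + m)) (a (n + m) / a n) ≤ -δ := by
  have hp : ∀ n, (0 : ℝ) < a n := fun n => Nat.cast_pos.2 (ha_pos n)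
  have hη0 : 0 < η := by positivity
  have hinv : Tendsto (fun n => v * a n / (a (n + 1) : ℝ)) atTop (𝓝 (v / η)) := by
    have := (hlim.inv₀ hη0.ne').const_mul v
    refine this.congr fun n => ?_
    rw [inv_div, mul_div_assoc]
  have hsmall : ∀ M : ℕ, ∃ δ > 0, ∃ n₀, ∀ n ≥ n₀, ∀ m ≥ 1, m < M →
      drift s (v * a (n + m - 1) / a (n + m)) (a (n + m) / a n) ≤ -δ := by
    intro M
    induction M with
    | zero => exact ⟨1, one_pos, 0, fun n _ m _ hm => by omega⟩
    | succ M ih =>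
      obtain ⟨δ, hδ, n₀, h0⟩ := ih
      rcases Nat.eq_zero_or_pos M with rfl | hM
      · exact ⟨1, one_pos, 0, fun n _ m _ hm => by omega⟩
      have h1 := tendsto_ratio_pow ha_pos hlim M
      have h2 := hinv.comp (tendsto_add_atTop_nat (M - 1))
      have hηM : η ^ M ≠ 0 := by positivity
      have h3 : Tendsto (fun n => drift s (v * a (n + (M - 1)) / a (n + (M - 1) + 1))
          (a (n + M) / a n)) atTop (𝓝 (drift s (v / η) (η ^ M))) := by
        unfold drift
        exact ((tendsto_const_nhds.sub h2).sub (tendsto_const_nhds.div h1 hηM)).sub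
          (((tendsto_const_nhds.add (h2.mul h1)).const_mul s).mul
            (tendsto_const_nhds.sub (tendsto_const_nhds.div h1 hηM)))
      have h4 := h M hM
      obtain ⟨n₁, h5⟩ := eventually_atTop.1
        (h3.eventually_le_const (show drift s (v / η) (η ^ M) < drift s (v / η) (η ^ M) / 2 by
          linarith))
      refine ⟨min δ (-(drift s (v / η) (η ^ M) / 2)), lt_min hδ (by linarith), max n₀ n₁,
        fun n hn m hm hmM => ?_⟩
      rcases Nat.lt_succ_iff_lt_or_eq.1 hmM with hlt | rfl
      · refine (h0 n (le_trans (le_max_left _ _) hn) m hm hlt).trans ?_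
        exact neg_le_neg (min_le_left _ _)
      · have h6 := h5 n (le_trans (le_max_right _ _) hn)
        rw [show n + (m - 1) = n + m - 1 by omega, show n + m - 1 + 1 = n + m by omega] at h6
        exact h6.trans (le_neg.1 (min_le_right _ _))
  set c := (1 + η) / 2 with hc
  have hc1 : 1 < c := by linarith
  obtain ⟨n₁, hn₁⟩ := eventually_atTop.1 (hlim.eventually_const_le (show c < η by linarith))
  have hn₁' : ∀ n ≥ n₁, c * a n ≤ a (n + 1) := fun n hn => (le_div_iff₀ (hp n)).1 (hn₁ n hn)
  set u₀ := v / (2 * η) with hu₀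
  have hu₀p : 0 < u₀ := by positivity
  obtain ⟨n₂, hn₂⟩ := eventually_atTop.1 (hinv.eventually_const_le (show u₀ < v / η by
    rw [hu₀, div_lt_div_iff₀ (by positivity) hη0]; nlinarith [mul_pos hv hη0]))
  -- This M gives s·u₀·(Q-1) ≥ 2 for all m ≥ M, hence drift at most -1.
  obtain ⟨M, hM⟩ := pow_unbounded_of_one_lt (1 + 2 / (s * u₀)) hc1
  obtain ⟨δ, hδ, n₃, h3⟩ := hsmall M
  refine ⟨min δ 1, lt_min hδ one_pos, max n₁ (max n₂ n₃), fun n hn m hm => ?_⟩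
  have hn1 : n₁ ≤ n := le_trans (le_max_left _ _) hn
  have hn2 : n₂ ≤ n := le_trans (le_trans (le_max_left _ _) (le_max_right _ _)) hn
  have hn3 : n₃ ≤ n := le_trans (le_trans (le_max_right _ _) (le_max_right _ _)) hn
  rcases lt_or_ge m M with hlt | hge
  · exact (h3 n hn3 m hm hlt).trans (neg_le_neg (min_le_left _ _))
  · refine le_trans ?_ (neg_le_neg (min_le_right _ _))
    have hu := hn₂ (n + m - 1) (by omega)
    rw [show n + m - 1 + 1 = n + m by omega] at hu
    have hQ : c ^ m ≤ (a (n + m) : ℝ) / a n :=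
      (le_div_iff₀ (hp n)).2 (pow_mul_le_of_ratio (by linarith) hn₁' n hn1 m)
    have hcM : c ^ M ≤ c ^ m := pow_le_pow_right₀ hc1.le hge
    set u := v * a (n + m - 1) / (a (n + m) : ℝ)
    set Q := (a (n + m) : ℝ) / a n
    have hQ2 : 2 / (s * u₀) ≤ Q - 1 := by linarith
    rw [div_le_iff₀ (by positivity)] at hQ2
    have hQ1 : 1 < Q := by
      have : 0 < 2 / (s * u₀) := by positivity
      linarith
    have e : drift s u Q = 1 - u - 1 / Q - s * u * (Q - 1) - s * (1 - 1 / Q) := by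
      unfold drift; field_simp; ring
    have e1 : 0 < 1 / Q := by positivity
    have e2 : 1 / Q < 1 := by rw [div_lt_one] <;> linarith
    have e3 : 0 ≤ s * (1 - 1 / Q) := mul_nonneg hs.le (by linarith)
    have e4 : s * u₀ * (Q - 1) ≤ s * u * (Q - 1) := by
      apply mul_le_mul_of_nonneg_right _ (by linarith)
      exact mul_le_mul_of_nonneg_left hu hs.le
    rw [e]
    linarith

/-! ### Free digits along a sequence of records -/

/-- The position at which the constant block of digits starting at `a n` ends, when the next record
is `n'`. -/
noncomputable def blockEnd (a : ℕ → ℕ) (v : ℝ) (n n' : ℕ) : ℝ := a n + v * a (n' - 1)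

/-- The number of free digits between the block starting at `a n` and `a n'`. -/
noncomputable def freeDigits (a : ℕ → ℕ) (v : ℝ) (n n' : ℕ) : ℝ := a n' - blockEnd a v n n'

theorem sum_freeDigits_le {a : ℕ → ℕ} {v : ℝ} (hv : 0 < v) (n : ℕ → ℕ) (k : ℕ) :
    ∑ j ∈ Finset.range k, freeDigits a v (n j) (n (j + 1)) ≤ a (n k) := by
  have : ∑ j ∈ Finset.range k, freeDigits a v (n j) (n (j + 1)) ≤
      ∑ j ∈ Finset.range k, ((a (n (j + 1)) : ℝ) - a (n j)) := by
    refine Finset.sum_le_sum fun j _ => ?_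
    unfold freeDigits blockEnd
    have : 0 ≤ v * (a (n (j + 1) - 1) : ℝ) := by positivity
    linarith
  rw [Finset.sum_range_sub (fun j => (a (n j) : ℝ))] at this
  have : (0 : ℝ) ≤ a (n 0) := by positivity
  linarith

/-- Along every sequence of positions, the number of free digits is infinitely often at most `s`
times the scale. -/
theorem frequently_sum_freeDigits_le {a : ℕ → ℕ} (ha_pos : ∀ n, 0 < a n)
    (ha : StrictMono a) {η : ℝ} (hη : 1 < η)
    (hlim : Tendsto (fun n => (a (n + 1) : ℝ) / (a n : ℝ)) atTop (𝓝 η)) {s v : ℝ} (hs : 0 < s)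
    (hv : 0 < v) (h : ∀ m : ℕ, 1 ≤ m → drift s (v / η) (η ^ m) < 0) {n : ℕ → ℕ}
    (hn : StrictMono n) (K : ℕ) :
    ∃ k ≥ K, ∑ j ∈ Finset.range k, freeDigits a v (n j) (n (j + 1)) ≤
      s * blockEnd a v (n k) (n (k + 1)) := by
  by_contra! hcon
  obtain ⟨δ, hδ, n₀, hdrift⟩ := exists_drift_le ha_pos hη hlim hs hv h
  have hp : ∀ n, (0 : ℝ) < a n := fun n => Nat.cast_pos.2 (ha_pos n)
  set S : ℕ → ℝ := fun k => ∑ j ∈ Finset.range k, freeDigits a v (n j) (n (j + 1)) with hS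
  set x : ℕ → ℝ := fun k => S k / a (n k) with hx
  have hstep : ∀ k ≥ max K n₀, x (k + 1) ≤ x k - δ := by
    intro k hk
    have hkK : K ≤ k := le_trans (le_max_left _ _) hk
    have hkn : n₀ ≤ n k := le_trans (le_trans (le_max_right _ _) hk) hn.le_apply
    have hlt : n k < n (k + 1) := hn (Nat.lt_succ_self k)
    have hd := hdrift (n k) hkn (n (k + 1) - n k) (by omega)
    rw [show n k + (n (k + 1) - n k) = n (k + 1) by omega] at hd
    have hSk : s * blockEnd a v (n k) (n (k + 1)) < S k := hcon k hkK
    have hSs : S (k + 1) = S k + freeDigits a v (n k) (n (k + 1)) := Finset.sum_range_succ _ _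
    have hA := hp (n k)
    have hA' := hp (n (k + 1))
    have hmono : (a (n k) : ℝ) ≤ a (n (k + 1)) := Nat.cast_le.2 (ha hlt).le
    simp only [hx, hSs]
    unfold freeDigits
    unfold blockEnd at *
    unfold drift at hd
    set A := (a (n k) : ℝ)
    set A' := (a (n (k + 1)) : ℝ)
    set B := (a (n (k + 1) - 1) : ℝ)
    have e0 : 0 ≤ 1 - A / A' := sub_nonneg.2 ((div_le_one hA').2 hmono)
    have e1 : s * (1 + v * B / A) ≤ S k / A := by
      rw [le_div_iff₀ hA]
      have : s * (1 + v * B / A) * A = s * (A + v * B) := by field_simp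
      linarith
    have e2 : (S k + (A' - (A + v * B))) / A' - S k / A =
        1 - v * B / A' - A / A' - S k / A * (1 - A / A') := by
      field_simp; ring
    have e3 : v * B / A' * (A' / A) = v * B / A := by field_simp
    have e4 : 1 / (A' / A) = A / A' := one_div_div _ _
    rw [e3, e4] at hd
    -- Replacing S k / A by its lower bound turns the exact increment `e2` into the drift.
    have e5 := mul_le_mul_of_nonneg_right e1 e0
    linarith
  have hiter : ∀ j : ℕ, x (max K n₀ + j) ≤ x (max K n₀) - j * δ := by
    intro j
    induction j with
    | zero => simp
    | succ j ih =>
      have := hstep (max K n₀ + j) (by omega)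
      rw [← add_assoc]
      push_cast
      linarith
  have hx1 : x (max K n₀) ≤ 1 := (div_le_one (hp _)).2 (sum_freeDigits_le hv n _)
  obtain ⟨j, hj⟩ := exists_nat_gt (1 / δ)
  rw [div_lt_iff₀ hδ] at hj
  have hneg : x (max K n₀ + j) < 0 := by linarith [hiter j]
  have hpos : 0 < x (max K n₀ + j) := by
    refine div_pos (lt_trans ?_ (hcon (max K n₀ + j) (by omega))) (hp _)
    have := hp (n (max K n₀ + j))
    unfold blockEnd
    positivity
  linarith

/-! ### Weighted counting of chains -/

open Classical in
/-- The weight of a transition from the approximation `p / b ^ a n` to `p' / b ^ a n'`. -/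
noncomputable def transitionWeight (b : ℕ) (a : ℕ → ℕ) (v : ℝ) (n : ℕ) (p : ℤ) (n' : ℕ) (p' : ℤ) :
    ℝ≥0∞ :=
  if -1 ≤ freeDigits a v n n' ∧
      |(p' - p * (b : ℤ) ^ (a n' - a n) : ℤ)| ≤ (b : ℝ) ^ freeDigits a v n n' + 1 then
    ENNReal.ofReal ((b : ℝ) ^ (-freeDigits a v n n')) else 0

open Classical in
/-- The sum, over all chains of transitions from `(n₀, p₀)` to `(n, p)`, of the products of the
transition weights. -/
noncomputable def chainWeight (b : ℕ) (a : ℕ → ℕ) (v : ℝ) (n₀ : ℕ) (p₀ : ℤ) (n' : ℕ) (p' : ℤ) :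
    ℝ≥0∞ :=
  (if n' = n₀ ∧ p' = p₀ then 1 else 0) + ∑ n : Fin n', ∑' p : ℤ,
    chainWeight b a v n₀ p₀ n p * transitionWeight b a v n p n' p'
termination_by n'
decreasing_by exact n.2

/-- At most 2b^f + 3 targets p' carry weight b^{-f}, and f ≥ -1 keeps b^{-f} at most b. -/
theorem tsum_transitionWeight_le {b : ℕ} (hb : 2 ≤ b) (a : ℕ → ℕ) (v : ℝ) (n : ℕ) (p : ℤ)
    (n' : ℕ) : ∑' p', transitionWeight b a v n p n' p' ≤ ((2 + 3 * b : ℕ) : ℝ≥0∞) := by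
  classical
  have hb0 : (0 : ℝ) < b := by positivity
  have hb1 : (1 : ℝ) ≤ b := by exact_mod_cast (by omega : 1 ≤ b)
  set f := freeDigits a v n n' with hf
  by_cases h : -1 ≤ f
  · set z := p * (b : ℤ) ^ (a n' - a n)
    set R := ⌊(b : ℝ) ^ f + 1⌋ with hR
    have hR0 : 0 ≤ R := Int.floor_nonneg.2 (by positivity)
    have hsupp : ∀ p' ∉ Finset.Icc (z - R) (z + R), transitionWeight b a v n p n' p' = 0 := by
      intro p' hp'
      unfold transitionWeight
      rw [if_neg]
      rintro ⟨-, h2⟩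
      apply hp'
      have h3 : |p' - z| ≤ R := Int.le_floor.2 h2
      rw [abs_le] at h3
      rw [Finset.mem_Icc]
      constructor <;> linarith
    rw [tsum_eq_sum hsupp]
    refine (Finset.sum_le_card_nsmul _ _ (ENNReal.ofReal ((b : ℝ) ^ (-f))) fun p' _ => ?_).trans ?_
    · unfold transitionWeight
      split_ifs
      · exact le_rfl
      · exact zero_le
    · rw [Int.card_Icc, nsmul_eq_mul, ← ENNReal.ofReal_natCast, ← ENNReal.ofReal_mul (by positivity),
        ← ENNReal.ofReal_natCast]
      apply ENNReal.ofReal_le_ofReal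
      have e1 : (((z + R + 1 - (z - R)).toNat : ℕ) : ℝ) = 2 * R + 1 := by
        have : (((z + R + 1 - (z - R)).toNat : ℕ) : ℤ) = 2 * R + 1 := by
          rw [Int.toNat_of_nonneg (by linarith)]; ring
        exact_mod_cast this
      have e2 : (R : ℝ) ≤ (b : ℝ) ^ f + 1 := Int.floor_le _
      have e3 : (b : ℝ) ^ (-f) ≤ b := by
        calc (b : ℝ) ^ (-f) ≤ (b : ℝ) ^ (1 : ℝ) := Real.rpow_le_rpow_of_exponent_le hb1 (by linarith)
          _ = b := Real.rpow_one _
      have e4 : (b : ℝ) ^ f * (b : ℝ) ^ (-f) = 1 := by rw [← Real.rpow_add hb0]; simp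
      have e5 : 0 < (b : ℝ) ^ (-f) := by positivity
      rw [e1]
      push_cast
      nlinarith
  · have : ∀ p', transitionWeight b a v n p n' p' = 0 := fun p' => if_neg fun h' => h h'.1
    simp [this]

/-- The recursion sums to the geometric identity 1 + Σ_{m<n} C^m (C-1) = C^n with C = 3 + 3b. -/
theorem tsum_chainWeight_le {b : ℕ} (hb : 2 ≤ b) (a : ℕ → ℕ) (v : ℝ) (n₀ : ℕ) (p₀ : ℤ) (n : ℕ) :
    ∑' p, chainWeight b a v n₀ p₀ n p ≤ ((3 + 3 * b : ℕ) : ℝ≥0∞) ^ n := by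
  classical
  induction n using Nat.strong_induction_on with
  | _ n ih =>
    have h1 : ∑' p, chainWeight b a v n₀ p₀ n p ≤
        1 + ∑ m : Fin n, (∑' p, chainWeight b a v n₀ p₀ m p) * ((2 + 3 * b : ℕ) : ℝ≥0∞) := by
      calc ∑' p, chainWeight b a v n₀ p₀ n p
          = ∑' p', ((if n = n₀ ∧ p' = p₀ then 1 else 0) + ∑ m : Fin n, ∑' p : ℤ,
              chainWeight b a v n₀ p₀ m p * transitionWeight b a v m p n p') := by
            congr 1; ext p'; rw [chainWeight]
        _ = ∑' p', (if n = n₀ ∧ p' = p₀ then 1 else 0) + ∑ m : Fin n, ∑' p : ℤ, ∑' p' : ℤ,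
              chainWeight b a v n₀ p₀ m p * transitionWeight b a v m p n p' := by
            rw [ENNReal.tsum_add, Summable.tsum_finsetSum fun _ _ => ENNReal.summable]
            congr 2
            ext m
            exact ENNReal.tsum_comm
        _ ≤ _ := by
            gcongr with m
            · rw [tsum_eq_single p₀ (fun p' hp' => if_neg fun h => hp' h.2)]
              split_ifs <;> simp
            · rw [← ENNReal.tsum_mul_right]
              refine ENNReal.tsum_le_tsum fun p => ?_
              rw [ENNReal.tsum_mul_left]
              gcongr
              exact tsum_transitionWeight_le hb a v m p n
    refine h1.trans ?_
    calc _ ≤ 1 + ∑ m : Fin n, ((3 + 3 * b : ℕ) : ℝ≥0∞) ^ (m : ℕ) * ((2 + 3 * b : ℕ) : ℝ≥0∞) := by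
          gcongr with m
          exact ih m m.2
      _ = ((3 + 3 * b : ℕ) : ℝ≥0∞) ^ n := by
          rw [Fin.sum_univ_eq_sum_range
            (fun m => ((3 + 3 * b : ℕ) : ℝ≥0∞) ^ m * ((2 + 3 * b : ℕ) : ℝ≥0∞)) n,
            ← Finset.sum_mul]
          norm_cast
          have h := geom_sum_mul_add (2 + 3 * b) n
          rw [show 2 + 3 * b + 1 = 3 + 3 * b by ring] at h
          rw [add_comm]; exact h

/-- A single chain contributes its own product of weights, so a chain with few free digits ends at a
point of large weight. -/
theorem ofReal_le_chainWeight {b : ℕ} (hb : 2 ≤ b) (a : ℕ → ℕ) (v : ℝ) {n : ℕ → ℕ} {p : ℕ → ℤ}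
    (hn : StrictMono n)
    (h : ∀ k, -1 ≤ freeDigits a v (n k) (n (k + 1)) ∧
      |(p (k + 1) - p k * (b : ℤ) ^ (a (n (k + 1)) - a (n k)) : ℤ)| ≤
        (b : ℝ) ^ freeDigits a v (n k) (n (k + 1)) + 1) (k : ℕ) :
    ENNReal.ofReal ((b : ℝ) ^ (-∑ j ∈ Finset.range k, freeDigits a v (n j) (n (j + 1)))) ≤
      chainWeight b a v (n 0) (p 0) (n k) (p k) := by
  classical
  have hb0 : (0 : ℝ) < b := by positivity
  induction k with
  | zero => rw [chainWeight]; simp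
  | succ k ih =>
    rw [Finset.sum_range_succ, neg_add, Real.rpow_add hb0, ENNReal.ofReal_mul (by positivity)]
    have hw : ENNReal.ofReal ((b : ℝ) ^ (-freeDigits a v (n k) (n (k + 1)))) =
        transitionWeight b a v (n k) (p k) (n (k + 1)) (p (k + 1)) := (if_pos (h k)).symm
    rw [hw]
    calc _ ≤ chainWeight b a v (n 0) (p 0) (n k) (p k) *
          transitionWeight b a v (n k) (p k) (n (k + 1)) (p (k + 1)) := by gcongr
      _ ≤ ∑' q, chainWeight b a v (n 0) (p 0) (n k) q *
          transitionWeight b a v (n k) q (n (k + 1)) (p (k + 1)) :=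
            ENNReal.le_tsum (f := fun q => chainWeight b a v (n 0) (p 0) (n k) q *
              transitionWeight b a v (n k) q (n (k + 1)) (p (k + 1))) (p k)
      _ ≤ ∑ m : Fin (n (k + 1)), ∑' q, chainWeight b a v (n 0) (p 0) m q *
          transitionWeight b a v m q (n (k + 1)) (p (k + 1)) :=
            Finset.single_le_sum (f := fun m : Fin (n (k + 1)) =>
              ∑' q, chainWeight b a v (n 0) (p 0) m q *
              transitionWeight b a v m q (n (k + 1)) (p (k + 1)))
              (fun _ _ => zero_le) (Finset.mem_univ ⟨n k, hn (Nat.lt_succ_self k)⟩)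
      _ ≤ _ := by
        conv_rhs => rw [chainWeight]
        exact le_add_self

/-! ### Covers and dimension of a chain set -/

/-- The real numbers with a chain of good approximations `p k / b ^ a (n k)` that starts at
`(n₀, p₀)`. -/
def chainSet (b : ℕ) (a : ℕ → ℕ) (v : ℝ) (n₀ : ℕ) (p₀ : ℤ) : Set ℝ :=
  {ξ : ℝ | ∃ (n : ℕ → ℕ) (p : ℕ → ℤ), StrictMono n ∧ n 0 = n₀ ∧ p 0 = p₀ ∧
    ∀ k, |(b : ℝ) ^ a (n k) * ξ - p k| < (b : ℝ) ^ (-(v * a (n (k + 1) - 1))) ∧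
      -1 ≤ freeDigits a v (n k) (n (k + 1))}

theorem abs_sub_mul_pow_le {b : ℕ} (hb : 2 ≤ b) {a : ℕ → ℕ} {v : ℝ} (hv : 0 < v) {ξ : ℝ}
    {n n' m : ℕ} {p p' : ℤ} (hnn : a n ≤ a n')
    (h : |(b : ℝ) ^ a n * ξ - p| < (b : ℝ) ^ (-(v * a (n' - 1))))
    (h' : |(b : ℝ) ^ a n' * ξ - p'| < (b : ℝ) ^ (-(v * a m))) :
    |(p' - p * (b : ℤ) ^ (a n' - a n) : ℤ)| ≤ (b : ℝ) ^ freeDigits a v n n' + 1 := by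
  have hb0 : (0 : ℝ) < b := by positivity
  have hb1 : (1 : ℝ) ≤ b := by exact_mod_cast (by omega : 1 ≤ b)
  have e1 : (b : ℝ) ^ freeDigits a v n n' =
      (b : ℝ) ^ (a n' - a n) * (b : ℝ) ^ (-(v * a (n' - 1))) := by
    rw [← Real.rpow_natCast, ← Real.rpow_add hb0, Nat.cast_sub hnn]
    congr 1
    unfold freeDigits blockEnd
    ring
  have e2 : (b : ℝ) ^ (-(v * a m)) ≤ 1 :=
    Real.rpow_le_one_of_one_le_of_nonpos hb1 (neg_nonpos.2 (by positivity))
  have e3 : (b : ℝ) ^ a n' = (b : ℝ) ^ (a n' - a n) * (b : ℝ) ^ a n := by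
    rw [← pow_add, Nat.sub_add_cancel hnn]
  have e4 : ((p' - p * (b : ℤ) ^ (a n' - a n) : ℤ) : ℝ) =
      (b : ℝ) ^ (a n' - a n) * ((b : ℝ) ^ a n * ξ - p) - ((b : ℝ) ^ a n' * ξ - p') := by
    rw [e3]; push_cast; ring
  rw [Int.cast_abs, e4, e1]
  refine (abs_sub _ _).trans (add_le_add ?_ (h'.le.trans e2))
  rw [abs_mul, abs_of_nonneg (by positivity : (0 : ℝ) ≤ (b : ℝ) ^ (a n' - a n))]
  gcongr

theorem tendsto_sub_atTop {a : ℕ → ℕ} (ha_pos : ∀ n, 0 < a n) (ha : StrictMono a) {η : ℝ}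
    (hη : 1 < η) (hlim : Tendsto (fun n => (a (n + 1) : ℝ) / (a n : ℝ)) atTop (𝓝 η)) :
    Tendsto (fun n => (a (n + 1) : ℝ) - a n) atTop atTop := by
  have h1 : Tendsto (fun n => (a n : ℝ)) atTop atTop :=
    tendsto_natCast_atTop_atTop.comp ha.tendsto_atTop
  have h2 := h1.atTop_mul_pos (sub_pos.2 hη) (hlim.sub_const 1)
  refine h2.congr fun n => ?_
  have : (a n : ℝ) ≠ 0 := Nat.cast_ne_zero.2 (ha_pos n).ne'
  field_simp

/-- The gaps of a tend to infinity, so consecutive terms have ratio tending to 0. -/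
theorem summable_pow_mul_rpow {b : ℕ} (hb : 2 ≤ b) {a : ℕ → ℕ} (ha_pos : ∀ n, 0 < a n)
    (ha : StrictMono a) {η : ℝ} (hη : 1 < η)
    (hlim : Tendsto (fun n => (a (n + 1) : ℝ) / (a n : ℝ)) atTop (𝓝 η)) {K δ : ℝ} (hK : 0 < K)
    (hδ : 0 < δ) : Summable fun N => K ^ N * (b : ℝ) ^ (-(δ * a N)) := by
  have hb0 : (0 : ℝ) < b := by positivity
  have hb1 : (1 : ℝ) < b := by exact_mod_cast hb
  refine summable_of_ratio_test_tendsto_lt_one (l := K * 0) (by simp)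
    (Eventually.of_forall fun N => by positivity) ?_
  have h1 : Tendsto (fun N => δ * ((a (N + 1) : ℝ) - a N)) atTop atTop :=
    (tendsto_sub_atTop ha_pos ha hη hlim).const_mul_atTop hδ
  have h2 := ((tendsto_rpow_atBot_of_base_gt_one (b : ℝ) hb1).comp
    (tendsto_neg_atTop_atBot.comp h1)).const_mul K
  refine h2.congr fun N => ?_
  rw [Real.norm_of_nonneg (by positivity), Real.norm_of_nonneg (by positivity)]
  simp only [Function.comp]
  rw [eq_div_iff (by positivity), pow_succ]
  have : (b : ℝ) ^ (-(δ * a (N + 1))) =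
      (b : ℝ) ^ (-(δ * ((a (N + 1) : ℝ) - a N))) * (b : ℝ) ^ (-(δ * a N)) := by
    rw [← Real.rpow_add hb0]; congr 1; ring
  rw [this]
  ring

open Classical in
/-- The covers of `chainSet`; the index is `(N, n, p)`. -/
noncomputable def chainCover (b : ℕ) (a : ℕ → ℕ) (v s : ℝ) (n₀ : ℕ) (p₀ : ℤ) (M : ℕ)
    (i : ℕ × ℕ × ℤ) : Set ℝ :=
  if M ≤ i.1 ∧ i.2.1 ≤ i.1 ∧ ENNReal.ofReal ((b : ℝ) ^ (-(s * blockEnd a v i.2.1 (i.1 + 1)))) ≤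
      chainWeight b a v n₀ p₀ i.2.1 i.2.2 then
    Set.Icc (i.2.2 / (b : ℝ) ^ a i.2.1 - (b : ℝ) ^ (-blockEnd a v i.2.1 (i.1 + 1)))
      (i.2.2 / (b : ℝ) ^ a i.2.1 + (b : ℝ) ^ (-blockEnd a v i.2.1 (i.1 + 1)))
  else ∅

theorem chainSet_subset_iUnion_chainCover {b : ℕ} (hb : 2 ≤ b) {a : ℕ → ℕ}
    (ha_pos : ∀ n, 0 < a n) (ha : StrictMono a) {η : ℝ} (hη : 1 < η)
    (hlim : Tendsto (fun n => (a (n + 1) : ℝ) / (a n : ℝ)) atTop (𝓝 η)) {s v : ℝ} (hs : 0 < s)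
    (hv : 0 < v) (h : ∀ m : ℕ, 1 ≤ m → drift s (v / η) (η ^ m) < 0) (n₀ : ℕ) (p₀ : ℤ) (M : ℕ) :
    chainSet b a v n₀ p₀ ⊆ ⋃ i, chainCover b a v s n₀ p₀ M i := by
  have hb0 : (0 : ℝ) < b := by positivity
  have hb1 : (1 : ℝ) ≤ b := by exact_mod_cast (by omega : 1 ≤ b)
  rintro ξ ⟨n, p, hn, rfl, rfl, hξ⟩
  obtain ⟨k, hk, hS⟩ := frequently_sum_freeDigits_le ha_pos ha hη hlim hs hv h hn M
  have hlt : n k < n (k + 1) := hn (Nat.lt_succ_self k)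
  have hle : k ≤ n k := hn.le_apply
  have hsucc : n (k + 1) - 1 + 1 = n (k + 1) := by omega
  -- N is the index just before the next record, so v·a(N) is the constant length in `blockEnd`.
  refine Set.mem_iUnion.2 ⟨(n (k + 1) - 1, n k, p k), ?_⟩
  unfold chainCover
  simp only [hsucc]
  rw [if_pos]
  · have e1 : (b : ℝ) ^ (-blockEnd a v (n k) (n (k + 1))) =
        (b : ℝ) ^ (-(v * a (n (k + 1) - 1))) / (b : ℝ) ^ a (n k) := by
      rw [eq_div_iff (by positivity), ← Real.rpow_natCast, ← Real.rpow_add hb0]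
      congr 1; unfold blockEnd; ring
    have e2 : |ξ - p k / (b : ℝ) ^ a (n k)| ≤ (b : ℝ) ^ (-blockEnd a v (n k) (n (k + 1))) := by
      rw [e1, le_div_iff₀ (by positivity)]
      have e3 : |(b : ℝ) ^ a (n k)| = (b : ℝ) ^ a (n k) := abs_of_nonneg (by positivity)
      rw [← e3, ← abs_mul, e3]
      refine le_trans (le_of_eq ?_) (hξ k).1.le
      congr 1
      field_simp
    rw [abs_le] at e2
    constructor <;> linarith
  · refine ⟨by omega, by omega, le_trans ?_ (ofReal_le_chainWeight hb a v hn (fun k => ⟨(hξ k).2,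
      abs_sub_mul_pow_le hb hv (ha (hn (Nat.lt_succ_self k))).le (hξ k).1 (hξ (k + 1)).1⟩) k)⟩
    exact ENNReal.ofReal_le_ofReal (Real.rpow_le_rpow_of_exponent_le hb1 (by linarith))

theorem blockEnd_succ_ge (a : ℕ → ℕ) (v : ℝ) (n N : ℕ) : v * a N ≤ blockEnd a v n (N + 1) := by
  unfold blockEnd
  simp

theorem ediam_chainCover_le {b : ℕ} (hb : 2 ≤ b) {a : ℕ → ℕ} (ha : StrictMono a) {v : ℝ}
    (hv : 0 < v) (s : ℝ) (n₀ : ℕ) (p₀ : ℤ) (M : ℕ) (i : ℕ × ℕ × ℤ) :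
    Metric.ediam (chainCover b a v s n₀ p₀ M i) ≤
      ENNReal.ofReal (2 * (b : ℝ) ^ (-(v * a M))) := by
  have hb1 : (1 : ℝ) ≤ b := by exact_mod_cast (by omega : 1 ≤ b)
  unfold chainCover
  split_ifs with h
  · rw [Real.ediam_Icc]
    apply ENNReal.ofReal_le_ofReal
    have e1 := blockEnd_succ_ge a v i.2.1 i.1
    have e2 : v * a M ≤ v * a i.1 :=
      mul_le_mul_of_nonneg_left (Nat.cast_le.2 (ha.monotone h.1)) hv.le
    have := Real.rpow_le_rpow_of_exponent_le hb1
      (show -blockEnd a v i.2.1 (i.1 + 1) ≤ -(v * a M) by linarith)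
    linarith
  · simp

/-- The s-th power of the radius is absorbed by the chain weight through the selection condition.
The remaining power d - s decays with a(N), as `blockEnd` is at least v·a(N). -/
theorem ediam_chainCover_rpow_le {b : ℕ} (hb : 2 ≤ b) (a : ℕ → ℕ) (v : ℝ) {s d : ℝ} (hs : 0 < s)
    (hsd : s < d) (n₀ : ℕ) (p₀ : ℤ) (M N n : ℕ) (p : ℤ) :
    Metric.ediam (chainCover b a v s n₀ p₀ M (N, n, p)) ^ d ≤
      if n ≤ N then chainWeight b a v n₀ p₀ n p *
        ENNReal.ofReal (2 ^ d * (b : ℝ) ^ (-((d - s) * v * a N))) else 0 := by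
  have hb0 : (0 : ℝ) < b := by positivity
  have hb1 : (1 : ℝ) ≤ b := by exact_mod_cast (by omega : 1 ≤ b)
  unfold chainCover
  by_cases h : M ≤ N ∧ n ≤ N ∧ ENNReal.ofReal ((b : ℝ) ^ (-(s * blockEnd a v n (N + 1)))) ≤
      chainWeight b a v n₀ p₀ n p
  · rw [if_pos h, if_pos h.2.1, Real.ediam_Icc]
    refine le_trans ?_ (mul_le_mul_left h.2.2 _)
    rw [ENNReal.ofReal_rpow_of_nonneg (by ring_nf; positivity) (by linarith),
      ← ENNReal.ofReal_mul (by positivity)]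
    apply ENNReal.ofReal_le_ofReal
    have e1 := mul_le_mul_of_nonneg_left (blockEnd_succ_ge a v n N) (sub_nonneg.2 hsd.le)
    set E := blockEnd a v n (N + 1)
    set c := (p : ℝ) / (b : ℝ) ^ a n
    rw [show c + (b : ℝ) ^ (-E) - (c - (b : ℝ) ^ (-E)) = 2 * (b : ℝ) ^ (-E) by ring,
      Real.mul_rpow (by norm_num) (by positivity), ← Real.rpow_mul hb0.le,
      show (b : ℝ) ^ (-(s * E)) * (2 ^ d * (b : ℝ) ^ (-((d - s) * v * a N))) =
        2 ^ d * ((b : ℝ) ^ (-(s * E)) * (b : ℝ) ^ (-((d - s) * v * a N))) by ring,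
      ← Real.rpow_add hb0]
    refine mul_le_mul_of_nonneg_left (Real.rpow_le_rpow_of_exponent_le hb1 ?_) (by positivity)
    linarith
  · rw [if_neg h, Metric.ediam_empty, ENNReal.zero_rpow_of_pos (by linarith)]
    exact zero_le

/-- The weights total at most C^N for each n ≤ N, and the decay in a(N) beats this exponential. One
convergent series bounds the sums of all the covers. -/
theorem dimH_chainSet_le {b : ℕ} (hb : 2 ≤ b) {a : ℕ → ℕ}
    (ha_pos : ∀ n, 0 < a n) (ha : StrictMono a) {η : ℝ} (hη : 1 < η)
    (hlim : Tendsto (fun n => (a (n + 1) : ℝ) / (a n : ℝ)) atTop (𝓝 η)) {s v d : ℝ} (hs : 0 < s)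
    (hv : 0 < v) (h : ∀ m : ℕ, 1 ≤ m → drift s (v / η) (η ^ m) < 0) (hsd : s < d)
    (n₀ : ℕ) (p₀ : ℤ) : dimH (chainSet b a v n₀ p₀) ≤ ENNReal.ofReal d := by
  have hb0 : (0 : ℝ) < b := by positivity
  have hb1 : (1 : ℝ) < b := by exact_mod_cast hb
  apply dimH_le_of_hausdorffMeasure_ne_top
  rw [Real.coe_toNNReal d (by linarith)]
  have hr : Tendsto (fun M => ENNReal.ofReal (2 * (b : ℝ) ^ (-(v * a M)))) atTop (𝓝 0) := by
    have h1 : Tendsto (fun n => v * (a n : ℝ)) atTop atTop :=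
      (tendsto_natCast_atTop_atTop.comp ha.tendsto_atTop).const_mul_atTop hv
    have h2 := ((tendsto_rpow_atBot_of_base_gt_one (b : ℝ) hb1).comp
      (tendsto_neg_atTop_atBot.comp h1)).const_mul 2
    have h3 := ENNReal.tendsto_ofReal h2
    simpa using h3
  set C : ℕ := 3 + 3 * b with hC
  have hsum : Summable fun N => (2 * C : ℝ) ^ N * (b : ℝ) ^ (-((d - s) * v * a N)) :=
    summable_pow_mul_rpow hb ha_pos ha hη hlim (by positivity) (mul_pos (sub_pos.2 hsd) hv)
  have hbound : ∀ M, ∑' i, Metric.ediam (chainCover b a v s n₀ p₀ M i) ^ d ≤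
      ∑' N, ENNReal.ofReal (2 ^ d * ((2 * C : ℝ) ^ N * (b : ℝ) ^ (-((d - s) * v * a N)))) := by
    intro M
    rw [ENNReal.tsum_prod']
    refine ENNReal.tsum_le_tsum fun N => ?_
    rw [ENNReal.tsum_prod']
    set c := ENNReal.ofReal (2 ^ d * (b : ℝ) ^ (-((d - s) * v * a N))) with hc
    calc _ ≤ ∑' n, ∑' p, (if n ≤ N then chainWeight b a v n₀ p₀ n p * c else 0) :=
          ENNReal.tsum_le_tsum fun n => ENNReal.tsum_le_tsum fun p =>
            ediam_chainCover_rpow_le hb a v hs hsd n₀ p₀ M N n p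
      _ = ∑ n ∈ Finset.range (N + 1), ∑' p, (if n ≤ N then chainWeight b a v n₀ p₀ n p * c else 0) := by
          refine tsum_eq_sum fun n hn => ?_
          have : ¬ n ≤ N := by simpa [Nat.lt_succ_iff] using hn
          simp [this]
      _ ≤ ∑ n ∈ Finset.range (N + 1), (C : ℝ≥0∞) ^ N * c := by
          refine Finset.sum_le_sum fun n hn => ?_
          have hnN : n ≤ N := by simpa [Nat.lt_succ_iff] using hn
          simp only [hnN, if_true]
          rw [ENNReal.tsum_mul_right]
          gcongr
          refine (tsum_chainWeight_le hb a v n₀ p₀ n).trans ?_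
          exact pow_le_pow_right₀ (by exact_mod_cast (by omega : 1 ≤ C)) hnN
      _ ≤ 2 ^ N * ((C : ℝ≥0∞) ^ N * c) := by
          rw [Finset.sum_const, Finset.card_range, nsmul_eq_mul]
          gcongr
          exact_mod_cast Nat.lt_two_pow_self
      _ = _ := by
          rw [← mul_assoc, ← mul_pow, hc]
          have : (2 * C : ℝ≥0∞) ^ N = ENNReal.ofReal ((2 * C : ℝ) ^ N) := by
            rw [ENNReal.ofReal_pow (by positivity), ENNReal.ofReal_mul (by norm_num)]
            simp
          rw [this, ← ENNReal.ofReal_mul (by positivity)]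
          congr 1
          ring
  refine ne_top_of_le_ne_top (hsum.mul_left (2 ^ d)).tsum_ofReal_ne_top ?_
  refine (MeasureTheory.Measure.hausdorffMeasure_le_liminf_tsum d _ _ hr
    (fun M i => chainCover b a v s n₀ p₀ M i)
    (Eventually.of_forall fun M i => ediam_chainCover_le hb ha hv s n₀ p₀ M i)
    (Eventually.of_forall fun M =>
      chainSet_subset_iUnion_chainCover hb ha_pos ha hη hlim hs hv h n₀ p₀ M)).trans ?_
  exact (liminf_le_liminf (Eventually.of_forall hbound)).trans (by simp)

/-! ### Reduction to chain sets -/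

theorem distNearestInt_eq_of_lt {x : ℝ} {z : ℤ} (h : |x - z| < 1 / 2) :
    distNearestInt x = |x - z| := by
  have hr : round x = z := by
    rw [abs_lt] at h
    rw [round_eq, Int.floor_eq_iff]
    constructor <;> linarith
  rw [distNearestInt, hr]

theorem distNearestInt_pos {b : ℕ} (hb : 2 ≤ b) {ξ : ℝ} (hξ : ξ ∉ Set.range ((↑) : ℚ → ℝ))
    (m : ℕ) : 0 < distNearestInt ((b : ℝ) ^ m * ξ) := by
  refine abs_pos.2 fun h => hξ ⟨round ((b : ℝ) ^ m * ξ) / (b : ℚ) ^ m, ?_⟩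
  have hb0 : (b : ℝ) ^ m ≠ 0 := by positivity
  push_cast
  rw [div_eq_iff hb0]
  linarith

theorem IsUniformExponent.of_lt_uniformExponent {b : ℕ} (hb : 2 ≤ b) {a : ℕ → ℕ} {ξ v w : ℝ}
    (hw : 0 ≤ w) (hwv : w < v) (h : ξ ∈ uniformSet b a v) : IsUniformExponent b a ξ w := by
  have h1 : ENNReal.ofReal w < uniformExponent b a ξ :=
    lt_of_lt_of_le ((ENNReal.ofReal_lt_ofReal_iff (by linarith)).2 hwv) h
  unfold uniformExponent at h1
  rw [lt_iSup_iff] at h1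
  obtain ⟨r, hr⟩ := h1
  rw [lt_iSup_iff] at hr
  obtain ⟨hr1, hr2⟩ := hr
  have hwr : w < r := by
    have := (ENNReal.ofReal_lt_iff_lt_toReal hw ENNReal.coe_ne_top).1 hr2
    simpa using this
  refine hr1.mono fun N ⟨n, hn, h2⟩ => ⟨n, hn, h2.trans_le ?_⟩
  apply Real.rpow_le_rpow_of_exponent_le _ (by linarith)
  exact one_le_pow₀ (by exact_mod_cast (by omega : 1 ≤ b))

/-- A sequence of positive reals with infimum zero has a sequence of successive records. -/
theorem exists_records {d : ℕ → ℝ} (hpos : ∀ n, 0 < d n) (hsmall : ∀ ε > 0, ∃ n, d n < ε) :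
    ∃ n : ℕ → ℕ, StrictMono n ∧ (∀ k, ∀ i < n (k + 1), d (n k) ≤ d i) ∧
      ∀ k, d (n (k + 1)) < d (n k) := by
  have hnext : ∀ r : {r : ℕ // ∀ i ≤ r, d r ≤ d i}, ∃ j : {r : ℕ // ∀ i ≤ r, d r ≤ d i},
      r.1 < j.1 ∧ (∀ i < j.1, d r.1 ≤ d i) ∧ d j.1 < d r.1 := by
    rintro ⟨r, hr⟩
    have hex := hsmall (d r) (hpos r)
    classical
    have hmin : ∀ i < Nat.find hex, d r ≤ d i := fun i hi => not_lt.1 (Nat.find_min hex hi)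
    refine ⟨⟨Nat.find hex, fun i hi => ?_⟩, ?_, hmin, Nat.find_spec hex⟩
    · rcases hi.lt_or_eq with hi | rfl
      · exact (Nat.find_spec hex).le.trans (hmin i hi)
      · exact le_rfl
    · by_contra hcon
      exact absurd (Nat.find_spec hex) (not_lt.2 (hr _ (not_lt.1 hcon)))
  choose f hf using hnext
  let start : {r : ℕ // ∀ i ≤ r, d r ≤ d i} := ⟨0, fun i hi => by rw [Nat.le_zero.1 hi]⟩
  have hsucc : ∀ k, f^[k + 1] start = f (f^[k] start) := fun k => Function.iterate_succ_apply' f k _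
  refine ⟨fun k => (f^[k] start).1, strictMono_nat_of_lt_succ fun k => ?_, fun k => ?_, fun k => ?_⟩
  · simp only [hsucc]; exact (hf _).1
  · simp only [hsucc]; exact (hf _).2.1
  · simp only [hsucc]; exact (hf _).2.2

/-- Records exist for irrational ξ because every distance is positive. The rationals are set aside,
being countable. -/
theorem uniformSet_subset {b : ℕ} (hb : 2 ≤ b) {a : ℕ → ℕ} (ha : StrictMono a) {v w : ℝ}
    (hw : 0 < w) (hwv : w < v) :
    uniformSet b a v ⊆ Set.range ((↑) : ℚ → ℝ) ∪ ⋃ i : ℕ × ℤ, chainSet b a w i.1 i.2 := by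
  intro ξ hξ
  by_cases hq : ξ ∈ Set.range ((↑) : ℚ → ℝ)
  · exact Or.inl hq
  right
  have hb0 : (0 : ℝ) < b := by positivity
  have hb1 : (1 : ℝ) < b := by exact_mod_cast hb
  set d : ℕ → ℝ := fun n => distNearestInt ((b : ℝ) ^ a n * ξ) with hd
  have hpos : ∀ n, 0 < d n := fun n => distNearestInt_pos hb hq _
  obtain ⟨N₀, hN₀⟩ := eventually_atTop.1
    (IsUniformExponent.of_lt_uniformExponent hb hw.le hwv hξ)
  have hN₀' : ∀ N ≥ N₀, ∃ n ≤ N, d n < (b : ℝ) ^ (-(w * a N)) := by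
    intro N hN
    obtain ⟨n, hn, h⟩ := hN₀ N hN
    refine ⟨n, hn, h.trans_eq ?_⟩
    rw [← Real.rpow_natCast, ← Real.rpow_mul hb0.le]
    congr 1; ring
  have hsmall : ∀ ε > 0, ∃ n, d n < ε := by
    intro ε hε
    have h1 : Tendsto (fun n => w * (a n : ℝ)) atTop atTop :=
      (tendsto_natCast_atTop_atTop.comp ha.tendsto_atTop).const_mul_atTop hw
    have h2 := (tendsto_rpow_atBot_of_base_gt_one (b : ℝ) hb1).comp
      (tendsto_neg_atTop_atBot.comp h1)
    obtain ⟨N, hN, hN'⟩ := ((h2.eventually_lt_const hε).and (eventually_ge_atTop N₀)).exists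
    obtain ⟨n, -, hn⟩ := hN₀' N hN'
    exact ⟨n, hn.trans hN⟩
  obtain ⟨n, hn, hrec, hdec⟩ := exists_records hpos hsmall
  have hclose : ∀ k ≥ N₀, d (n k) < (b : ℝ) ^ (-(w * a (n (k + 1) - 1))) := by
    intro k hk
    have h1 : n k < n (k + 1) := hn (Nat.lt_succ_self k)
    have h2 : k ≤ n k := hn.le_apply
    obtain ⟨i, hi, h3⟩ := hN₀' (n (k + 1) - 1) (by omega)
    exact (hrec k i (by omega)).trans_lt h3
  -- Were this product below 1/2, it would equal the distance at the next record, which would then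
  -- not be smaller than d (n k).
  have hgap : ∀ k, 1 / 2 ≤ (b : ℝ) ^ (a (n (k + 1)) - a (n k)) * d (n k) := by
    intro k
    by_contra! hcon
    have hle : a (n k) ≤ a (n (k + 1)) := (ha (hn (Nat.lt_succ_self k))).le
    set g := a (n (k + 1)) - a (n k) with hg
    have e3 : (b : ℝ) ^ a (n (k + 1)) = (b : ℝ) ^ g * (b : ℝ) ^ a (n k) := by
      rw [← pow_add, Nat.sub_add_cancel hle]
    have e4 : |(b : ℝ) ^ a (n (k + 1)) * ξ -
        ((b : ℤ) ^ g * round ((b : ℝ) ^ a (n k) * ξ) : ℤ)| = (b : ℝ) ^ g * d (n k) := by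
      rw [e3]
      simp only [hd, distNearestInt]
      rw [← abs_of_nonneg (by positivity : (0 : ℝ) ≤ (b : ℝ) ^ g), ← abs_mul]
      push_cast
      rw [abs_of_nonneg (by positivity : (0 : ℝ) ≤ (b : ℝ) ^ g)]
      congr 1
      ring
    have e5 : d (n (k + 1)) = (b : ℝ) ^ g * d (n k) := by
      rw [← e4]; exact distNearestInt_eq_of_lt (e4 ▸ hcon)
    have e6 : d (n k) ≤ (b : ℝ) ^ g * d (n k) :=
      le_mul_of_one_le_left (hpos _).le (one_le_pow₀ hb1.le)
    linarith [hdec k]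
  have hfree : ∀ k ≥ N₀, -1 ≤ freeDigits a w (n k) (n (k + 1)) := by
    intro k hk
    have hle : a (n k) ≤ a (n (k + 1)) := (ha (hn (Nat.lt_succ_self k))).le
    have h1 : (b : ℝ) ^ (-1 : ℝ) < (b : ℝ) ^ freeDigits a w (n k) (n (k + 1)) := by
      calc (b : ℝ) ^ (-1 : ℝ) ≤ 1 / 2 := by
            rw [Real.rpow_neg_one, ← one_div]
            exact one_div_le_one_div_of_le (by norm_num) (by exact_mod_cast hb)
        _ ≤ (b : ℝ) ^ (a (n (k + 1)) - a (n k)) * d (n k) := hgap k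
        _ < (b : ℝ) ^ (a (n (k + 1)) - a (n k)) * (b : ℝ) ^ (-(w * a (n (k + 1) - 1))) := by
            gcongr
            exact hclose k hk
        _ = _ := by
            rw [← Real.rpow_natCast, ← Real.rpow_add hb0, Nat.cast_sub hle]
            congr 1
            unfold freeDigits blockEnd
            ring
    exact ((Real.rpow_lt_rpow_left_iff hb1).1 h1).le
  -- The chain starts at record N₀, from which on the exponent inequality is available.
  refine Set.mem_iUnion.2 ⟨(n N₀, round ((b : ℝ) ^ a (n N₀) * ξ)), fun k => n (k + N₀),
    fun k => round ((b : ℝ) ^ a (n (k + N₀)) * ξ), fun i j hij => hn (by omega), ?_, ?_, fun k => ?_⟩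
  · simp
  · simp
  · have h1 := hclose (k + N₀) (by omega)
    have h2 := hfree (k + N₀) (by omega)
    rw [show k + N₀ + 1 = k + 1 + N₀ by omega] at h1 h2
    exact ⟨h1, h2⟩

/-! ### The dimension bound -/

theorem theorem12 (b : ℕ) (hb : 2 ≤ b) (a : ℕ → ℕ) (ha_pos : ∀ n, 0 < a n) (ha : StrictMono a)
    (η : ℝ) (hη : 1 < η)
    (hlim : Tendsto (fun n => (a (n + 1) : ℝ) / (a n : ℝ)) atTop (𝓝 η))
    (v : ℝ) (hv : v ∈ parameterSet η) :
    dimH (uniformSet b a v) ≤ ENNReal.ofReal (dimensionBound η v (lOne η v)) ∧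
      dimensionBound η v (lOne η v) < ((η - v) / (η + v)) ^ 2 := by
  obtain ⟨hl, hlow, hupp⟩ := parameterSet_spec hη hv
  have hη0 : 0 < η := by positivity
  generalize hlv : lOne η v = l at *
  lift l to ℕ using by omega
  rw [zpow_natCast] at hlow hupp
  have hl1 : 1 ≤ l := by omega
  have hQ : η ≤ η ^ l := le_self_pow₀ hη.le (by omega)
  set u := v / η with hu
  have hvu : v = u * η := by rw [hu]; field_simp
  have h1 : 2 / (η * η ^ l) < 1 - u := by
    rw [div_lt_iff₀ (by positivity)] at hlow ⊢
    rw [hvu] at hlow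
    linarith
  have h2 : 1 - u < 2 / (η ^ l + 1) := by
    rw [lt_div_iff₀ (by positivity)] at hupp ⊢
    rw [hvu] at hupp
    nlinarith
  have hu0 : 0 < u := by
    have : 2 / (η ^ l + 1) < 1 := by rw [div_lt_one] <;> linarith
    linarith
  have hDeq := dimensionBound_eq hη v (l : ℤ)
  rw [zpow_natCast] at hDeq
  set D := dimensionBound η v l
  constructor
  · obtain ⟨hD, hmax⟩ := max_bound hη hQ hu0 h1 h2 hDeq
    refine le_of_forall_gt_imp_ge_of_dense fun c hc => ?_
    rcases eq_or_ne c ⊤ with rfl | hctop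
    · exact le_top
    have hDs : D < c.toReal := (ENNReal.ofReal_lt_iff_lt_toReal hD.le hctop).1 hc
    obtain ⟨u', s, hu', huu, hs, hsc, hdrift⟩ := exists_params_drift_neg hη hu0 hD hDs
      fun m hm => hmax (η ^ m) (one_lt_pow₀ hη (by omega)) (by
        rcases le_or_gt m l with h | h
        · exact Or.inl (pow_le_pow_right₀ hη.le h)
        · right
          rw [← pow_succ']
          exact pow_le_pow_right₀ hη.le h)
    have hw : 0 < u' * η := by positivity
    have hwv : u' * η < v := by rw [hvu]; exact mul_lt_mul_of_pos_right huu hη0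
    refine (dimH_mono (uniformSet_subset hb ha hw hwv)).trans ?_
    rw [dimH_union, dimH_countable (Set.countable_range _), dimH_iUnion]
    refine max_le zero_le (iSup_le fun i => ?_)
    rw [← ENNReal.ofReal_toReal hctop]
    refine dimH_chainSet_le hb ha_pos ha hη hlim hs hw (fun m hm => ?_) hsc i.1 i.2
    rw [mul_div_cancel_right₀ _ hη0.ne']
    exact hdrift m hm
  · have := max_lt_sq hη hQ hu0 h1 h2
    rw [hDeq]
    refine this.trans_eq ?_
    congr 1
    rw [hvu]
    field_simp
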